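/- Let $\mathcal{C}=\mathbb{Q}[\hbar,\hbar^{-1}]$ and let $\widehat{\mathfrak{H}^1}=\mathcal{C}\langle e_1,g_1,g_2,\dots\rangle$ be the non-commutative polynomial ring, which is freely generated by the alphabet $\mathcal{A}=\{e_1-g_1\}\sqcup\{g_k\mid k\ge 1\}$. Put $e_k=g_k+\hbar g_{k-1}$ for $k\ge 2$. Let $\mathfrak{z}$ be the free $\mathcal{C}$-module spanned by $\mathcal{A}$, with the symmetric $\mathcal{C}$-bilinear product $\circ_\hbar$ given by $$(e_1-g_1)\circ_\hbar(e_1-g_1)=\hbar(e_1-g_1),\qquad (e_1-g_1)\circ_\hbar g_k=\hbar g_k,\qquad g_k\circ_\hbar g_l=g_{k+l}\qquad(k,l\ge 1),$$ and write $u^{\circ_\hbar n}$ for the $n$-th power of $u\in\mathfrak{z}$ with respect to $\circ_\hbar$ ($n\ge 1$). The harmonic product $\ast_\hbar$ on $\widehat{\mathfrak{H}^1}$ is the $\mathcal{C}$-bilinear product determined by $w\ast_\hbar 1=1\ast_\hbar w=w$ and $$(wu)\ast_\hbar(w'v)=(w\ast_\hbar w'v)u+(wu\ast_\hbar w')v+(w\ast_\hbar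 w')(u\circ_\hbar v)\qquad(w,w'\in\widehat{\mathfrak{H}^1},\ u,v\in\mathcal{A}).$$ It is extended coefficientwise to $\widehat{\mathfrak{H}^1}[[X]]$, and for $f\in X\widehat{\mathfrak{H}^1}[[X]]$ put $\exp_{\ast_\hbar}(f)=1+\sum_{n\ge 1}\frac{1}{n!}f^{\ast_\hbar n}$. For $k\ge 1$ let $$\phi_k=\sum_{j=1}^{k}(j-1)!\,S(k,j)\,\hbar^{k-j}g_j,$$ where $S(k,j)$ is the Stirling number of the second kind. For $n\ge 1$ let $H_0(n)=1$ and $$H_r(n)=\sum_{0<m_1<\cdots<m_r<n}\frac{1}{m_1\cdots m_r}\qquad(r\ge 1),$$ and for $m\ge 0$ and $n_1,n_2\ge 1$ let $C_m(n_1,n_2)=\sum_{a=0}^{m}(-1)^{m-a}H_a(n_1)H_{m-a}(n_2)$. **Theorem 4.5.** For all integers $N\ge 2$ and $L\ge 1$, the following identity holds in $\widehat{\mathfrak{H}^1}[[X]]$: $$\frac{1}{1+(-1)^{(N-1)L}\hbar^{-NL}e_N^{\circ_\hbar L}X}=\exp_{\ast_\hbar}\left(\frac{N}{(N-1)L}\sum_{n\ge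 1}\frac{X^n}{n^2\binom{NLn}{Ln}}\sum_{k=2}^{NLn}C_{k-2}(Ln,(N-1)Ln)\,\hbar^{-k}\phi_k\right),$$ where the inverse on the left-hand side is taken with respect to the ordinary (concatenation) product. -/

import Mathlib

open scoped PowerSeries

noncomputable section

namespace HarmonicAlgebra

/-- The Laurent polynomial ring `ℚ[ħ, ħ⁻¹]`; the power `ħ ^ m`, for an integer `m`, is
`LaurentPolynomial.T m`. -/
abbrev Coeff : Type := LaurentPolynomial ℚ

/-- The power `ħ ^ m` for an integer `m`. -/
def hbar (m : ℤ) : Coeff := LaurentPolynomial.T m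

/-- The alphabet `{e₁ - g₁} ⊔ {g_k ∣ k ≥ 1}`; the letter `d` stands for `e₁ - g₁`. -/
inductive Letter : Type
  | d : Letter
  | g (k : ℕ+) : Letter

/-- The noncommutative polynomial ring over `ℚ[ħ, ħ⁻¹]` in the variables `e₁, g₁, g₂, …`.
It is freely generated by the letters `d = e₁ - g₁` and `g_k`, so it is defined as the free
algebra on these; the variable `e₁` is recovered as `d + g₁`. -/
abbrev H1 : Type := FreeAlgebra Coeff Letter

/-- The free `ℚ[ħ, ħ⁻¹]`-module spanned by the alphabet. -/
abbrev Z : Type := Letter →₀ Coeff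

/-- The inclusion of the span of the alphabet into the noncommutative polynomial ring. -/
def incl : Z →ₗ[Coeff] H1 := Finsupp.linearCombination Coeff (FreeAlgebra.ι Coeff)

/-- The element `e₁ - g₁`. -/
def dElt : Z := Finsupp.single Letter.d 1

/-- The element `g_k` for `k ≥ 1` (with the junk value `0` for `k = 0`). -/
def gElt (k : ℕ) : Z := if h : 0 < k then Finsupp.single (Letter.g ⟨k, h⟩) 1 else 0

/-- The elements `e₁ = (e₁ - g₁) + g₁` and `e_k = g_k + ħ g_{k-1}` for `k ≥ 2`
(with the junk value `0` for `k = 0`). -/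
def eElt : ℕ → Z
  | 0 => 0
  | 1 => dElt + gElt 1
  | k + 2 => gElt (k + 2) + hbar 1 • gElt (k + 1)

/-- The product `u ∘ v` of two letters. -/
def circLetter : Letter → Letter → Z
  | Letter.d, Letter.d => hbar 1 • Finsupp.single Letter.d 1
  | Letter.d, Letter.g k => hbar 1 • Finsupp.single (Letter.g k) 1
  | Letter.g k, Letter.d => hbar 1 • Finsupp.single (Letter.g k) 1
  | Letter.g k, Letter.g l => Finsupp.single (Letter.g (k + l)) 1

/-- The bilinear product `∘` on the span of the alphabet. -/
def circ : Z →ₗ[Coeff] Z →ₗ[Coeff] Z :=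
  Finsupp.linearCombination Coeff
    (fun u => Finsupp.linearCombination Coeff (fun v => circLetter u v))

/-- The power `u^{∘ n}` for `n ≥ 1` (with the junk value `0` for `n = 0`). -/
def circPow (u : Z) : ℕ → Z
  | 0 => 0
  | 1 => u
  | n + 2 => circ (circPow u (n + 1)) u

/-- The harmonic product of two words. A word `u₁ ⋯ u_r` is given by the list
`[u_r, …, u₁]` of its letters from right to left. -/
def harmonicWord : List Letter → List Letter → H1
  | [], [] => 1
  | [], v :: w' => harmonicWord [] w' * FreeAlgebra.ι Coeff v
  | u :: w, [] => harmonicWord w [] * FreeAlgebra.ι Coeff u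
  | u :: w, v :: w' =>
      harmonicWord w (v :: w') * FreeAlgebra.ι Coeff u
        + harmonicWord (u :: w) w' * FreeAlgebra.ι Coeff v
        + harmonicWord w w' * incl (circLetter u v)
  termination_by w w' => w.length + w'.length

/-- The harmonic product, extended bilinearly from words. It is the bilinear product that is
characterized by `harmonic_one`, `one_harmonic` and `harmonic_mul_letter` below. -/
def harmonic : H1 →ₗ[Coeff] H1 →ₗ[Coeff] H1 :=
  (FreeAlgebra.basisFreeMonoid Coeff Letter).constr Coeff fun w =>
    (FreeAlgebra.basisFreeMonoid Coeff Letter).constr Coeff fun w' =>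
      harmonicWord w.toList.reverse w'.toList.reverse

theorem basis_apply (w : FreeMonoid Letter) :
    FreeAlgebra.basisFreeMonoid Coeff Letter w =
      FreeMonoid.lift (FreeAlgebra.ι Coeff) w := by
  simp [FreeAlgebra.basisFreeMonoid, FreeAlgebra.equivMonoidAlgebraFreeMonoid]

theorem harmonic_basis (w w' : FreeMonoid Letter) :
    harmonic (FreeMonoid.lift (FreeAlgebra.ι Coeff) w)
      (FreeMonoid.lift (FreeAlgebra.ι Coeff) w') =
      harmonicWord w.toList.reverse w'.toList.reverse := by
  rw [← basis_apply, ← basis_apply, harmonic, Module.Basis.constr_basis,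
    Module.Basis.constr_basis]

theorem harmonicWord_nil_left (l : List Letter) :
    harmonicWord [] l = FreeMonoid.lift (FreeAlgebra.ι Coeff) (FreeMonoid.ofList l.reverse) := by
  induction l with
  | nil => simp [harmonicWord]
  | cons v l ih => simp [harmonicWord, ih, FreeMonoid.ofList_append]

theorem harmonicWord_nil_right (l : List Letter) :
    harmonicWord l [] = FreeMonoid.lift (FreeAlgebra.ι Coeff) (FreeMonoid.ofList l.reverse) := by
  induction l with
  | nil => simp [harmonicWord]
  | cons v l ih => simp [harmonicWord, ih, FreeMonoid.ofList_append]

/-- The defining property `w * 1 = w` of the harmonic product. -/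
theorem harmonic_one (w : H1) : harmonic w 1 = w := by
  suffices h : harmonic.flip 1 = LinearMap.id from LinearMap.congr_fun h w
  refine (FreeAlgebra.basisFreeMonoid Coeff Letter).ext fun b => ?_
  have := harmonic_basis b 1
  rw [map_one] at this
  simp [basis_apply, this, harmonicWord_nil_right]

/-- The defining property `1 * w = w` of the harmonic product. -/
theorem one_harmonic (w : H1) : harmonic 1 w = w := by
  suffices h : harmonic 1 = LinearMap.id from LinearMap.congr_fun h w
  refine (FreeAlgebra.basisFreeMonoid Coeff Letter).ext fun b => ?_
  have := harmonic_basis 1 b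
  rw [map_one] at this
  simp [basis_apply, this, harmonicWord_nil_left]

/-- The defining property
`(w u) * (w' v) = (w * w' v) u + (w u * w') v + (w * w') (u ∘ v)` of the harmonic product,
for letters `u` and `v`. -/
theorem harmonic_mul_letter (w w' : H1) (u v : Letter) :
    harmonic (w * FreeAlgebra.ι Coeff u) (w' * FreeAlgebra.ι Coeff v) =
      harmonic w (w' * FreeAlgebra.ι Coeff v) * FreeAlgebra.ι Coeff u
        + harmonic (w * FreeAlgebra.ι Coeff u) w' * FreeAlgebra.ι Coeff v
        + harmonic w w' * incl (circ (Finsupp.single u 1) (Finsupp.single v 1)) := by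
  have hc : circ (Finsupp.single u 1) (Finsupp.single v 1) = circLetter u v := by
    simp [circ]
  rw [hc]
  let R (x : H1) : H1 →ₗ[Coeff] H1 := LinearMap.mulRight Coeff x
  have key : harmonic.compl₁₂ (R (FreeAlgebra.ι Coeff u)) (R (FreeAlgebra.ι Coeff v)) =
      (harmonic.compl₁₂ LinearMap.id (R (FreeAlgebra.ι Coeff v))).compr₂
          (R (FreeAlgebra.ι Coeff u))
        + (harmonic.compl₁₂ (R (FreeAlgebra.ι Coeff u)) LinearMap.id).compr₂
          (R (FreeAlgebra.ι Coeff v))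
        + harmonic.compr₂ (R (incl (circLetter u v))) := by
    refine (FreeAlgebra.basisFreeMonoid Coeff Letter).ext fun b => ?_
    refine (FreeAlgebra.basisFreeMonoid Coeff Letter).ext fun b' => ?_
    have h1 : FreeMonoid.lift (FreeAlgebra.ι Coeff) b * FreeAlgebra.ι Coeff u =
        FreeMonoid.lift (FreeAlgebra.ι Coeff) (b * FreeMonoid.of u) := by simp
    have h2 : FreeMonoid.lift (FreeAlgebra.ι Coeff) b' * FreeAlgebra.ι Coeff v =
        FreeMonoid.lift (FreeAlgebra.ι Coeff) (b' * FreeMonoid.of v) := by simp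
    simp only [basis_apply, LinearMap.compl₁₂_apply, LinearMap.add_apply, LinearMap.compr₂_apply,
      LinearMap.id_apply, R, LinearMap.mulRight_apply]
    rw [h1, h2]
    simp only [harmonic_basis, FreeMonoid.toList_mul, FreeMonoid.toList_of, List.reverse_append,
      List.reverse_singleton, List.singleton_append]
    rw [harmonicWord]
  exact LinearMap.congr_fun (LinearMap.congr_fun key w) w'

/-- The harmonic product of formal power series. -/
def harmonicSeries (f g : H1⟦X⟧) : H1⟦X⟧ :=
  PowerSeries.mk fun n =>
    ∑ p ∈ Finset.HasAntidiagonal.antidiagonal n, harmonic (PowerSeries.coeff p.1 f) (PowerSeries.coeff p.2 g)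

/-- The powers of a formal power series with respect to the harmonic product. -/
def harmonicPow (f : H1⟦X⟧) : ℕ → H1⟦X⟧
  | 0 => 1
  | n + 1 => harmonicSeries (harmonicPow f n) f

/-- The exponential `1 + ∑_{m ≥ 1} f^{* m} / m!` with respect to the harmonic product, for a
formal power series `f` without constant term. The `m`-th power of such an `f` is divisible by
`X ^ m` (see `coeff_harmonicPow_of_lt`), so only the terms with `m ≤ n` contribute to the
coefficient of `X ^ n`. -/
def harmonicExp (f : H1⟦X⟧) : H1⟦X⟧ :=
  PowerSeries.mk fun n =>
    ∑ m ∈ Finset.range (n + 1), (1 / (m.factorial : ℚ)) • PowerSeries.coeff n (harmonicPow f m)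

theorem coeff_harmonicPow_of_lt (f : H1⟦X⟧) (hf : PowerSeries.coeff 0 f = 0) (m n : ℕ)
    (h : n < m) : PowerSeries.coeff n (harmonicPow f m) = 0 := by
  induction m generalizing n with
  | zero => omega
  | succ m ih =>
    rw [harmonicPow, harmonicSeries, PowerSeries.coeff_mk]
    refine Finset.sum_eq_zero fun p hp => ?_
    rw [Finset.HasAntidiagonal.mem_antidiagonal] at hp
    by_cases h2 : p.2 = 0
    · rw [h2, hf, map_zero]
    · rw [ih p.1 (by omega), map_zero, LinearMap.zero_apply]

/-- The element `φ_k = ∑_{j = 1}^k (j - 1)! S(k, j) ħ^{k - j} g_j`, where `S(k, j)` is the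
Stirling number of the second kind. -/
def phi (k : ℕ) : Z :=
  ∑ j ∈ Finset.Icc 1 k,
    (((j - 1).factorial * Nat.stirlingSecond k j : ℕ) : ℚ) • hbar ((k : ℤ) - j) • gElt j

/-- The multiple harmonic sum `H_r(n)`, the sum of `1 / (m₁ ⋯ m_r)` over all
`0 < m₁ < ⋯ < m_r < n`, that is, over all `r`-element subsets `{m₁, …, m_r}` of the open
interval `(0, n)`; in particular `H_0(n) = 1`. -/
def multiHarmonic (r n : ℕ) : ℚ :=
  ∑ s ∈ (Finset.Ioo 0 n).powersetCard r, ∏ m ∈ s, 1 / (m : ℚ)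

/-- The number `C_m(n₁, n₂) = ∑_{a = 0}^m (-1)^{m - a} H_a(n₁) H_{m - a}(n₂)`. -/
def convHarmonic (m n₁ n₂ : ℕ) : ℚ :=
  ∑ a ∈ Finset.range (m + 1), (-1) ^ (m - a) * multiHarmonic a n₁ * multiHarmonic (m - a) n₂

/-- The formal power series `1 / (1 + p X)`, where powers of `p` are taken with respect to
the ordinary (concatenation) product. -/
def geomSeries (p : H1) : H1⟦X⟧ :=
  PowerSeries.invOfUnit (1 + PowerSeries.C p * PowerSeries.X) 1

/-- The exponent
`N / ((N-1) L) ∑_{n ≥ 1} X^n / (n² binom(NLn, Ln)) ∑_{k=2}^{NLn} C_{k-2}(Ln, (N-1)Ln) ħ^{-k} φ_k`,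
a formal power series without constant term. -/
def exponent (N L : ℕ) : H1⟦X⟧ :=
  PowerSeries.mk fun n =>
    if n = 0 then 0
    else
      ((N : ℚ) / (((N : ℚ) - 1) * L) * (1 / ((n : ℚ) ^ 2 * ((N * L * n).choose (L * n) : ℚ)))) •
        ∑ k ∈ Finset.Icc 2 (N * L * n),
          convHarmonic (k - 2) (L * n) ((N - 1) * L * n) • incl (hbar (-(k : ℤ)) • phi k)

end HarmonicAlgebra

end

open scoped PowerSeries

namespace HarmonicAlgebra

/-! ### Polynomial side: the operator `D = s (s + 1) d/ds` on `ℚ[s]`. -/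

section Polynomials

open Polynomial

/-! The identity is transported from the one-variable polynomial ring. The map `gMap`, `s ^ i ↦ ħ ^
(-i) g_i`, is multiplicative from the ideal `sℚ[s]` to `∘`. It sends `s ^ (N - 1) (s + 1)` to `ħ ^
(-N) e_N`, and it sends `D ^ (k - 2) (s (s + 1))` to `ħ ^ (-k) φ_k`, by the Stirling recurrence.

Since the `C_m(a + 1, b + 1)` are the coefficients of `∏_{m ≤ a} (1 + x / m) ∏_{m ≤ b} (1 - x / m)`,
the inner sum over `k` is this polynomial in `D` applied to `s (s + 1)`. Each factor raises one
exponent by one, so the result is a multiple of `s ^ (b + 1) (s + 1) ^ (a + 1)` (`aeval_convPoly`).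
For `a + 1 = Ln`, `b + 1 = (N - 1)Ln` this is the `Ln`-th power of `s ^ (N - 1) (s + 1)`, and the
binomial prefactor turns the scalar into `±1/n`.

The exponent is therefore `-∑ v ^ {∘ n} X ^ n / n`, a `∘`-logarithm, and what remains is the
quasi-shuffle identity `1 / (1 + v X) = exp_*(-∑ v ^ {∘ n} X ^ n / n)`
(`geomSeries_eq_harmonicExp`). Both sides solve `X E' = E * X f'`. -/

/-- The multiple harmonic sums `H_r(n)` are the coefficients of `∏_{0 < m < n} (1 + x / m)`. -/
theorem coeff_prod_one_add (r n : ℕ) (c : ℚ) :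
    (∏ m ∈ Finset.Ioo 0 n, (1 + C (c / (m : ℚ)) * X)).coeff r = c ^ r * multiHarmonic r n := by
  have h (t : Finset ℕ) : ∏ m ∈ t, (C (c / (m : ℚ)) * X) =
      C (c ^ t.card * ∏ m ∈ t, 1 / (m : ℚ)) * X ^ t.card := by
    rw [Finset.prod_mul_distrib, Finset.prod_const, ← map_prod]
    simp only [div_eq_mul_inv, Finset.prod_mul_distrib, Finset.prod_const, one_mul]
  simp only [Finset.prod_one_add, h, finsetSum_coeff, coeff_C_mul_X_pow, multiHarmonic,
    Finset.powersetCard_eq_filter, Finset.sum_filter, Finset.mul_sum]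
  refine Finset.sum_congr rfl fun t _ => ?_
  by_cases ht : r = t.card
  · simp [ht]
  · simp [ht, Ne.symm ht]

/-- The polynomial `∏_{m < a} (1 + x / m) ∏_{m < b} (1 - x / m)`. -/
noncomputable def convPoly (a b : ℕ) : ℚ[X] :=
  (∏ m ∈ Finset.Ioo 0 a, (1 + C (1 / (m : ℚ)) * X)) *
    ∏ m ∈ Finset.Ioo 0 b, (1 + C (-1 / (m : ℚ)) * X)

theorem coeff_convPoly (m a b : ℕ) : (convPoly a b).coeff m = convHarmonic m a b := by
  rw [convPoly, coeff_mul, Finset.Nat.sum_antidiagonal_eq_sum_range_succ_mk, convHarmonic]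
  refine Finset.sum_congr rfl fun i _ => ?_
  rw [coeff_prod_one_add, coeff_prod_one_add]
  ring

theorem natDegree_prod_one_add_le (n : ℕ) (c : ℚ) :
    (∏ m ∈ Finset.Ioo 0 n, (1 + C (c / (m : ℚ)) * X)).natDegree ≤ n - 1 := by
  refine (natDegree_prod_le _ _).trans ((Finset.sum_le_card_nsmul _ _ 1 fun m _ => ?_).trans ?_)
  · compute_degree
  · simp

theorem natDegree_convPoly_le (a b : ℕ) : (convPoly a b).natDegree ≤ (a - 1) + (b - 1) :=
  natDegree_mul_le.trans
    (add_le_add (natDegree_prod_one_add_le a 1) (natDegree_prod_one_add_le b (-1)))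

theorem prod_Ioo_succ {M : Type*} [CommMonoid M] (f : ℕ → M) (n : ℕ) :
    ∏ m ∈ Finset.Ioo 0 (n + 2), f m = (∏ m ∈ Finset.Ioo 0 (n + 1), f m) * f (n + 1) := by
  have h : Finset.Ioo 0 (n + 2) = insert (n + 1) (Finset.Ioo 0 (n + 1)) := by
    ext; simp; omega
  rw [h, Finset.prod_insert (by simp), mul_comm]

theorem convPoly_one_one : convPoly 1 1 = 1 := by
  have h : Finset.Ioo 0 1 = ∅ := by decide
  simp [convPoly, h]

theorem convPoly_succ_left (a b : ℕ) :
    convPoly (a + 2) b = (1 + C (1 / ((a + 1 : ℕ) : ℚ)) * X) * convPoly (a + 1) b := by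
  rw [convPoly, convPoly, prod_Ioo_succ]; ring

theorem convPoly_succ_right (a b : ℕ) :
    convPoly a (b + 2) = (1 + C (-1 / ((b + 1 : ℕ) : ℚ)) * X) * convPoly a (b + 1) := by
  rw [convPoly, convPoly, prod_Ioo_succ]; ring

/-- The operator `s (s + 1) d/ds`. -/
noncomputable def eulerOp : Module.End ℚ ℚ[X] :=
  (LinearMap.mulLeft ℚ (X * (X + 1))).comp derivative

theorem eulerOp_apply (p : ℚ[X]) : eulerOp p = X * (X + 1) * derivative p := rfl

theorem eulerOp_pow_mul_pow (a b : ℕ) :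
    eulerOp (X ^ b * (X + 1) ^ a) =
      C (b : ℚ) * (X ^ b * (X + 1) ^ (a + 1)) + C (a : ℚ) * (X ^ (b + 1) * (X + 1) ^ a) := by
  rw [eulerOp_apply, derivative_mul, derivative_X_pow, derivative_pow]
  rcases a with _ | a <;> rcases b with _ | b <;> simp <;> ring

/-- For `p = s ^ b (s + 1) ^ (a + 1)` one has `D p = b (s + 1) p + (a + 1) s p`. Dividing by `a + 1`
leaves the term `s p`, which merges with `p` into `(s + 1) p`; everything is then a multiple of `(s
+ 1) p`. The next lemma is the mirror image, where `p - (s + 1) p = -s p`. -/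
theorem add_smul_eulerOp_left (a b : ℕ) :
    (X ^ b * (X + 1) ^ (a + 1) : ℚ[X]) +
        (1 / ((a + 1 : ℕ) : ℚ)) • eulerOp (X ^ b * (X + 1) ^ (a + 1)) =
      (((a + b + 1 : ℕ) : ℚ) / ((a + 1 : ℕ) : ℚ)) • (X ^ b * (X + 1) ^ (a + 2)) := by
  have h : ((a + 1 : ℕ) : ℚ) ≠ 0 := by positivity
  apply smul_right_injective ℚ[X] h
  simp only [smul_add, smul_smul]
  rw [mul_one_div_cancel h, mul_div_cancel₀ _ h, eulerOp_pow_mul_pow, one_smul]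
  simp only [smul_eq_C_mul]
  push_cast
  simp only [map_add, map_natCast, map_one]
  ring

theorem add_smul_eulerOp_right (a b : ℕ) :
    (X ^ (b + 1) * (X + 1) ^ a : ℚ[X]) +
        (-1 / ((b + 1 : ℕ) : ℚ)) • eulerOp (X ^ (b + 1) * (X + 1) ^ a) =
      (-(((a + b + 1 : ℕ) : ℚ) / ((b + 1 : ℕ) : ℚ))) • (X ^ (b + 2) * (X + 1) ^ a) := by
  have h : ((b + 1 : ℕ) : ℚ) ≠ 0 := by positivity
  apply smul_right_injective ℚ[X] h
  simp only [smul_add, smul_smul, mul_neg]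
  rw [mul_div_cancel₀ _ h, mul_div_cancel₀ _ h, eulerOp_pow_mul_pow, neg_smul, one_smul, neg_smul]
  simp only [smul_eq_C_mul]
  push_cast
  simp only [map_add, map_natCast, map_one]
  ring

theorem aeval_one_add_C_mul_X_mul (c : ℚ) (q p : ℚ[X]) :
    aeval eulerOp ((1 + C c * X) * q) p =
      aeval eulerOp q p + c • eulerOp (aeval eulerOp q p) := by
  rw [map_mul (aeval eulerOp)]
  simp [Algebra.algebraMap_eq_smul_one]

theorem aeval_convPoly (a b : ℕ) :
    aeval eulerOp (convPoly (a + 1) (b + 1)) (X * (X + 1)) =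
      ((-1) ^ b * ((a + b + 1).factorial : ℚ) / (a.factorial * b.factorial)) •
        (X ^ (b + 1) * (X + 1) ^ (a + 1)) := by
  induction b with
  | zero =>
    induction a with
    | zero => simp [convPoly_one_one]
    | succ a ih =>
      rw [convPoly_succ_left, aeval_one_add_C_mul_X_mul, ih, map_smul, smul_comm, ← smul_add,
        add_smul_eulerOp_left, smul_smul]
      congr 1
      simp only [Nat.factorial_succ, add_zero]
      push_cast
      field_simp
  | succ b ih =>
    rw [convPoly_succ_right, aeval_one_add_C_mul_X_mul, ih, map_smul, smul_comm, ← smul_add,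
      add_smul_eulerOp_right, smul_smul]
    congr 1
    rw [← add_assoc a b 1, Nat.factorial_succ (a + b + 1), Nat.factorial_succ b, pow_succ]
    push_cast
    field_simp
    ring

/-- The polynomial `∑_{j = 1}^k (j - 1)! S(k, j) s^j`. -/
noncomputable def phiPoly (k : ℕ) : ℚ[X] :=
  ∑ j ∈ Finset.Icc 1 k, (((j - 1).factorial * Nat.stirlingSecond k j : ℕ) : ℚ) • X ^ j

/-- The index `k + 1` makes the formula valid for `j = 0` too: there `(j - 1)!` is `1` in `ℕ`, but
`S(k + 1, 0) = 0`. -/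
theorem coeff_phiPoly_succ (k j : ℕ) :
    (phiPoly (k + 1)).coeff j =
      (((j - 1).factorial * Nat.stirlingSecond (k + 1) j : ℕ) : ℚ) := by
  simp only [phiPoly, finsetSum_coeff, coeff_smul, coeff_X_pow, smul_eq_mul, mul_ite, mul_one,
    mul_zero]
  rw [Finset.sum_ite_eq]
  split_ifs with h
  · rfl
  · rw [Finset.mem_Icc, not_and_or] at h
    rcases h with h | h
    · rw [show j = 0 by omega, Nat.stirlingSecond_succ_zero]; simp
    · rw [Nat.stirlingSecond_eq_zero_of_lt (by omega)]; simp

/-- In `S(k + 1, j) = j S(k, j) + S(k, j - 1)` the two terms, multiplied by `(j - 1)!`, are the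
contributions of `s d/ds` and `s² d/ds`. The recursion starts only at `phiPoly 1 = s`, because
`phiPoly 0 = 0`. -/
theorem phiPoly_add_two (k : ℕ) : phiPoly (k + 2) = eulerOp (phiPoly (k + 1)) := by
  have h : eulerOp (phiPoly (k + 1)) =
      X * derivative (phiPoly (k + 1)) + X * (X * derivative (phiPoly (k + 1))) := by
    rw [eulerOp_apply]; ring
  ext j
  rw [h, coeff_add, coeff_phiPoly_succ]
  rcases j with _ | _ | j
  · simp
  · simp [coeff_X_mul, coeff_derivative, coeff_phiPoly_succ, Nat.stirlingSecond_one_right]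
  · rw [coeff_X_mul, coeff_X_mul, coeff_X_mul, coeff_derivative, coeff_derivative,
      coeff_phiPoly_succ, coeff_phiPoly_succ, Nat.stirlingSecond_succ_succ]
    simp only [Nat.add_sub_cancel, Nat.factorial_succ]
    push_cast
    ring

theorem phiPoly_eq_pow_eulerOp (k : ℕ) : phiPoly (k + 2) = (eulerOp ^ k) (X * (X + 1)) := by
  induction k with
  | zero =>
    simp [phiPoly, Finset.sum_Icc_succ_top, Nat.stirlingSecond]
    ring
  | succ k ih => rw [phiPoly_add_two, ih, pow_succ', Module.End.mul_apply]

/-- The linear map `x ^ k ↦ ∑_{j = 1}^k (j - 1)! S(k, j) s ^ j` sends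
`x² ∏_{m ≤ a} (1 + x / m) ∏_{m ≤ b} (1 - x / m)` to a multiple of `s ^ (b + 1) (s + 1) ^ (a + 1)`. -/
theorem sum_convHarmonic_smul_phiPoly (a b : ℕ) :
    ∑ k ∈ Finset.Icc 2 (a + b + 2), convHarmonic (k - 2) (a + 1) (b + 1) • phiPoly k =
      ((-1) ^ b * ((a + b + 1).factorial : ℚ) / (a.factorial * b.factorial)) •
        (X ^ (b + 1) * (X + 1) ^ (a + 1)) := by
  rw [← aeval_convPoly, aeval_eq_sum_range' (n := a + b + 1)
    (Nat.lt_succ_of_le (natDegree_convPoly_le (a + 1) (b + 1))), LinearMap.sum_apply,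
    ← Finset.Ico_add_one_right_eq_Icc, Finset.sum_Ico_eq_sum_range]
  refine Finset.sum_congr (by congr 1) fun k _ => ?_
  rw [LinearMap.smul_apply, ← phiPoly_eq_pow_eulerOp, coeff_convPoly, Nat.add_sub_cancel_left,
    add_comm 2 k]

end Polynomials

/-! ### Harmonic multiplication by elements of degree one. -/

section

open FreeAlgebra

theorem incl_single (u : Letter) : incl (Finsupp.single u 1) = ι Coeff u := by
  simp [incl]

theorem circ_single (u v : Letter) :
    circ (Finsupp.single u 1) (Finsupp.single v 1) = circLetter u v := by
  simp [circ]

theorem circ_single_single (u v : Letter) (a b : Coeff) :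
    circ (Finsupp.single u a) (Finsupp.single v b) = (a * b) • circLetter u v := by
  simp [circ, smul_smul]

theorem linearMap_ext_Z {M : Type*} [AddCommMonoid M] [Module Coeff M] {f g : Z →ₗ[Coeff] M}
    (h : ∀ u, f (Finsupp.single u 1) = g (Finsupp.single u 1)) : f = g := by
  ext u
  simpa using h u

theorem harmonic_mul_incl (w w' : H1) (u v : Z) :
    harmonic (w * incl u) (w' * incl v) =
      harmonic w (w' * incl v) * incl u + harmonic (w * incl u) w' * incl v
        + harmonic w w' * incl (circ u v) := by
  have h (w w' : H1) :
      (harmonic.compl₁₂ (LinearMap.mulLeft Coeff w ∘ₗ incl) (LinearMap.mulLeft Coeff w' ∘ₗ incl)) =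
      ((LinearMap.mul Coeff H1).compl₁₂ (harmonic w ∘ₗ LinearMap.mulLeft Coeff w' ∘ₗ incl)
          incl).flip
        + (LinearMap.mul Coeff H1).compl₁₂ (harmonic.flip w' ∘ₗ LinearMap.mulLeft Coeff w ∘ₗ incl)
          incl
        + circ.compr₂ (LinearMap.mulLeft Coeff (harmonic w w') ∘ₗ incl) := by
    refine linearMap_ext_Z fun u => linearMap_ext_Z fun v => ?_
    simpa [incl_single] using harmonic_mul_letter w w' u v
  simpa using LinearMap.congr_fun (LinearMap.congr_fun (h w w') u) v

theorem harmonic_mul_incl_incl (w : H1) (u v : Z) :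
    harmonic (w * incl u) (incl v) =
      harmonic w (incl v) * incl u + w * incl u * incl v + w * incl (circ u v) := by
  simpa [harmonic_one] using harmonic_mul_incl w 1 u v

theorem circLetter_comm (u v : Letter) : circLetter u v = circLetter v u := by
  rcases u with _ | k <;> rcases v with _ | l <;> simp [circLetter, add_comm]

theorem circ_comm (u v : Z) : circ u v = circ v u := by
  have h : circ = circ.flip :=
    linearMap_ext_Z fun u => linearMap_ext_Z fun v => by
      simp [circ_single, circLetter_comm u v]
  exact LinearMap.congr_fun (LinearMap.congr_fun h u) v

/-- On letters, `d` acts as `ħ` times the identity and the indices of the `g_k` add. -/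
theorem circ_right_comm (x u v : Z) : circ (circ x u) v = circ (circ x v) u := by
  have h (x : Z) : circ ∘ₗ circ x = (circ ∘ₗ circ x).flip := by
    refine linearMap_ext_Z fun u => linearMap_ext_Z fun v => ?_
    have h' : circ.flip (Finsupp.single v 1) ∘ₗ circ.flip (Finsupp.single u 1) =
        circ.flip (Finsupp.single u 1) ∘ₗ circ.flip (Finsupp.single v 1) := by
      refine linearMap_ext_Z fun x => ?_
      rcases x with _ | i <;> rcases u with _ | k <;> rcases v with _ | l <;>
        simp [circ_single_single, circLetter, add_right_comm]
      rw [add_comm]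
    simpa using LinearMap.congr_fun h' x
  exact LinearMap.congr_fun (LinearMap.congr_fun (h x) u) v

/-- Harmonic multiplications by elements of degree one commute with each other. -/
theorem harmonic_right_comm (w : H1) (u v : Z) :
    harmonic (harmonic w (incl u)) (incl v) = harmonic (harmonic w (incl v)) (incl u) := by
  suffices h : harmonic.flip (incl v) ∘ₗ harmonic.flip (incl u) =
      harmonic.flip (incl u) ∘ₗ harmonic.flip (incl v) from LinearMap.congr_fun h w
  refine (basisFreeMonoid Coeff Letter).ext fun b => ?_
  rw [basis_apply]
  -- The recursion for `*` peels off the last letter, so the induction runs over the reversed word.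
  obtain ⟨l, rfl⟩ : ∃ l : List Letter, b = FreeMonoid.ofList l.reverse := ⟨b.toList.reverse, by simp⟩
  simp only [LinearMap.comp_apply, LinearMap.flip_apply]
  induction l with
  | nil =>
    have h (u v : Z) : harmonic (incl u) (incl v) =
        incl v * incl u + incl u * incl v + incl (circ u v) := by
      simpa [one_harmonic] using harmonic_mul_incl_incl 1 u v
    simp only [List.reverse_nil, FreeMonoid.ofList_nil, map_one, one_harmonic]
    rw [h, h, circ_comm v u]
    abel
  | cons x l ih =>
    simp only [List.reverse_cons, FreeMonoid.ofList_append, map_mul, FreeMonoid.ofList_singleton,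
      FreeMonoid.lift_eval_of, ← incl_single]
    simp only [harmonic_mul_incl_incl, map_add, LinearMap.add_apply, add_mul]
    rw [ih, circ_right_comm _ u v, circ_comm u v]
    abel

end

/-! ### The harmonic exponential and its differential equation. -/

section

open Finset

theorem coeff_harmonicPow_succ (f : H1⟦X⟧) (m n : ℕ) :
    PowerSeries.coeff n (harmonicPow f (m + 1)) = ∑ p ∈ HasAntidiagonal.antidiagonal n,
      harmonic (PowerSeries.coeff p.1 (harmonicPow f m)) (PowerSeries.coeff p.2 f) := by
  rw [harmonicPow, harmonicSeries, PowerSeries.coeff_mk]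

/-- This is `X (f ^ {m + 1})' = (m + 1) f ^ m * X f'`, with `n •` playing the role of `X d/dX`.
Powers are nested to the left, so `harmonic_right_comm` replaces full associativity and
commutativity of `*`. -/
theorem nsmul_coeff_harmonicPow_succ (f : H1⟦X⟧) (v : ℕ → Z)
    (hf : ∀ n, PowerSeries.coeff n f = incl (v n)) (m n : ℕ) :
    n • PowerSeries.coeff n (harmonicPow f (m + 1)) =
      (m + 1) • ∑ p ∈ HasAntidiagonal.antidiagonal n,
        harmonic (PowerSeries.coeff p.1 (harmonicPow f m)) (p.2 • incl (v p.2)) := by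
  induction m generalizing n with
  | zero =>
    rw [coeff_harmonicPow_succ, zero_add, one_smul, smul_sum]
    refine sum_congr rfl fun p hp => ?_
    rw [HasAntidiagonal.mem_antidiagonal] at hp
    rw [harmonicPow, PowerSeries.coeff_one, hf]
    split_ifs with h
    · rw [map_nsmul, ← hp, h, zero_add]
    · simp
  | succ m ih =>
    have hsplit : n • PowerSeries.coeff n (harmonicPow f (m + 2)) =
        ∑ p ∈ HasAntidiagonal.antidiagonal n,
          harmonic (p.1 • PowerSeries.coeff p.1 (harmonicPow f (m + 1))) (incl (v p.2)) +
        ∑ p ∈ HasAntidiagonal.antidiagonal n,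
          harmonic (PowerSeries.coeff p.1 (harmonicPow f (m + 1))) (p.2 • incl (v p.2)) := by
      rw [coeff_harmonicPow_succ, smul_sum, ← sum_add_distrib]
      refine sum_congr rfl fun p hp => ?_
      rw [HasAntidiagonal.mem_antidiagonal] at hp
      rw [map_nsmul, map_nsmul, LinearMap.smul_apply, ← add_smul, hp, hf]
    have hswap : ∑ p ∈ HasAntidiagonal.antidiagonal n,
          harmonic (p.1 • PowerSeries.coeff p.1 (harmonicPow f (m + 1))) (incl (v p.2)) =
        (m + 1) • ∑ p ∈ HasAntidiagonal.antidiagonal n,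
          harmonic (PowerSeries.coeff p.1 (harmonicPow f (m + 1))) (p.2 • incl (v p.2)) := by
      simp only [ih]
      simp only [coeff_harmonicPow_succ, map_nsmul, map_sum, LinearMap.smul_apply,
        LinearMap.sum_apply, ← smul_sum, hf]
      congr 1
      simp only [smul_sum]
      rw [sum_sigma', sum_sigma']
      -- The involution exchanges the degrees `b` and `d` of the last two factors, which commute.
      refine sum_nbij' (fun x => ⟨(x.2.1 + x.1.2, x.2.2), (x.2.1, x.1.2)⟩)
        (fun x => ⟨(x.2.1 + x.1.2, x.2.2), (x.2.1, x.1.2)⟩) ?_ ?_ ?_ ?_ ?_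
      · rintro ⟨⟨a, b⟩, c, d⟩ h
        simp only [mem_sigma, HasAntidiagonal.mem_antidiagonal] at h ⊢
        refine ⟨?_, trivial⟩
        change c + b + d = n
        omega
      · rintro ⟨⟨a, b⟩, c, d⟩ h
        simp only [mem_sigma, HasAntidiagonal.mem_antidiagonal] at h ⊢
        refine ⟨?_, trivial⟩
        change c + b + d = n
        omega
      · rintro ⟨⟨a, b⟩, c, d⟩ h
        simp only [mem_sigma, HasAntidiagonal.mem_antidiagonal] at h
        simp [h.2]
      · rintro ⟨⟨a, b⟩, c, d⟩ h
        simp only [mem_sigma, HasAntidiagonal.mem_antidiagonal] at h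
        simp [h.2]
      · rintro ⟨⟨a, b⟩, c, d⟩ h
        simp only [harmonic_right_comm _ (v d) (v b)]
    rw [hsplit, hswap, ← succ_nsmul]

/-- The exponential satisfies the differential equation `X E' = E * X f'`. -/
theorem nsmul_coeff_harmonicExp (f : H1⟦X⟧) (v : ℕ → Z)
    (hf : ∀ n, PowerSeries.coeff n f = incl (v n)) (h0 : v 0 = 0) (n : ℕ) :
    n • PowerSeries.coeff n (harmonicExp f) =
      ∑ p ∈ HasAntidiagonal.antidiagonal n,
        harmonic (PowerSeries.coeff p.1 (harmonicExp f)) (p.2 • incl (v p.2)) := by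
  have hf0 : PowerSeries.coeff 0 f = 0 := by rw [hf, h0, map_zero]
  -- Lengthening the truncation of the exponential adds only zero terms, so one range serves all
  -- coefficients below `n`.
  have hext (i : ℕ) (hi : i < n) : PowerSeries.coeff i (harmonicExp f) =
      ∑ m ∈ range n, (1 / (m.factorial : ℚ)) • PowerSeries.coeff i (harmonicPow f m) := by
    rw [harmonicExp, PowerSeries.coeff_mk]
    refine sum_subset (range_subset_range.2 hi) fun m _ hm => ?_
    rw [coeff_harmonicPow_of_lt f hf0 m i (by simpa using hm), smul_zero]
  have hr : ∀ p ∈ HasAntidiagonal.antidiagonal n,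
      harmonic (PowerSeries.coeff p.1 (harmonicExp f)) (p.2 • incl (v p.2)) =
      ∑ m ∈ range n, (1 / (m.factorial : ℚ)) •
        harmonic (PowerSeries.coeff p.1 (harmonicPow f m)) (p.2 • incl (v p.2)) := by
    intro p hp
    rw [HasAntidiagonal.mem_antidiagonal] at hp
    rcases Nat.eq_zero_or_pos p.2 with h | h
    · simp [h]
    · rw [hext p.1 (by omega), map_sum, LinearMap.sum_apply]
      refine sum_congr rfl fun m _ => ?_
      rw [LinearMap.map_smul_of_tower harmonic, LinearMap.smul_apply]
  rw [sum_congr rfl hr, sum_comm, harmonicExp, PowerSeries.coeff_mk, smul_sum, sum_range_succ']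
  have hlast : n • (1 / (Nat.factorial 0 : ℚ)) • PowerSeries.coeff n (harmonicPow f 0) = 0 := by
    rw [harmonicPow, PowerSeries.coeff_one]
    split_ifs with h <;> simp [h]
  rw [hlast, add_zero]
  refine sum_congr rfl fun m _ => ?_
  rw [← smul_sum, smul_comm, nsmul_coeff_harmonicPow_succ f v hf, ← Nat.cast_smul_eq_nsmul ℚ,
    smul_smul]
  congr 1
  rw [Nat.factorial_succ]
  push_cast
  field_simp

/-- The term with `p.2 = 0` vanishes, so the equation determines the `n`-th coefficient from lower
ones after division by `n`. -/
theorem harmonicExp_eq_of_nsmul_coeff (f g : H1⟦X⟧) (v : ℕ → Z)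
    (hf : ∀ n, PowerSeries.coeff n f = incl (v n)) (h0 : v 0 = 0)
    (hg0 : PowerSeries.coeff 0 g = 1)
    (hg : ∀ n, n • PowerSeries.coeff n g = ∑ p ∈ HasAntidiagonal.antidiagonal n,
      harmonic (PowerSeries.coeff p.1 g) (p.2 • incl (v p.2))) :
    g = harmonicExp f := by
  ext n
  induction n using Nat.strong_induction_on with
  | _ n ih =>
    rcases Nat.eq_zero_or_pos n with rfl | hn
    · simp [hg0, harmonicExp, harmonicPow]
    · have h : (n : ℚ) • PowerSeries.coeff n g = (n : ℚ) • PowerSeries.coeff n (harmonicExp f) := by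
        rw [Nat.cast_smul_eq_nsmul, Nat.cast_smul_eq_nsmul, hg,
          nsmul_coeff_harmonicExp f v hf h0]
        refine sum_congr rfl fun p hp => ?_
        rw [HasAntidiagonal.mem_antidiagonal] at hp
        rcases Nat.eq_zero_or_pos p.2 with h | h
        · simp [h]
        · rw [ih p.1 (by omega)]
      have hn' : (n : ℚ) ≠ 0 := by positivity
      rw [← inv_smul_smul₀ hn' (PowerSeries.coeff n g), h, inv_smul_smul₀ hn']

/-! ### The geometric series as a harmonic exponential. -/

theorem neg_one_pow_succ_mul (n : ℕ) (x : H1) : (-1) ^ (n + 1) * x = -((-1) ^ n * x) := by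
  have h {R : Type} [Ring R] (x : R) : (-1) ^ (n + 1) * x = -((-1) ^ n * x) := by
    rw [pow_succ, mul_neg_one, neg_mul]
  exact h x

theorem coeff_geomSeries (p : H1) (n : ℕ) :
    PowerSeries.coeff n (geomSeries p) = (-1) ^ n * p ^ n := by
  have h : (1 + PowerSeries.C p * PowerSeries.X) * geomSeries p = 1 :=
    PowerSeries.mul_invOfUnit _ 1 (by simp)
  induction n with
  | zero => simpa [add_mul, mul_assoc] using congrArg (PowerSeries.coeff 0) h
  | succ n ih =>
    have h' := congrArg (PowerSeries.coeff (n + 1)) h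
    rw [add_mul, one_mul, map_add, mul_assoc, PowerSeries.coeff_C_mul,
      PowerSeries.coeff_succ_X_mul, ih, PowerSeries.coeff_one, if_neg n.succ_ne_zero] at h'
    rw [eq_neg_of_add_eq_zero_left h', ← mul_assoc, ((Commute.neg_one_right p).pow_right n).eq, mul_assoc, ← pow_succ',
      neg_one_pow_succ_mul]

/-- The sum `∑_{a + b = k} p^a u p^b`. -/
noncomputable def insertSum (p u : H1) (k : ℕ) : H1 :=
  ∑ q ∈ HasAntidiagonal.antidiagonal k, p ^ q.1 * u * p ^ q.2

theorem insertSum_succ (p u : H1) (k : ℕ) :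
    insertSum p u (k + 1) = p ^ (k + 1) * u + insertSum p u k * p := by
  rw [insertSum, Nat.sum_antidiagonal_succ', insertSum, sum_mul]
  simp [pow_succ, mul_assoc]

theorem insertSum_self (p : H1) (k : ℕ) : insertSum p p k = (k + 1) • p ^ (k + 1) := by
  rw [insertSum, sum_congr rfl (g := fun _ => p ^ (k + 1)), sum_const, Nat.card_antidiagonal]
  intro q hq
  rw [HasAntidiagonal.mem_antidiagonal] at hq
  rw [← pow_succ, ← pow_add]
  congr 1
  omega

/-- In the product with a word `u ^ (k + 1)`, `v` is either inserted in one of the `k + 2` gaps or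
merged with one of the `k + 1` letters. -/
theorem harmonic_pow_succ_incl (u v : Z) (k : ℕ) :
    harmonic (incl u ^ (k + 1)) (incl v) =
      insertSum (incl u) (incl v) (k + 1) + insertSum (incl u) (incl (circ u v)) k := by
  induction k with
  | zero =>
    have := harmonic_mul_incl_incl 1 u v
    rw [one_mul, one_harmonic, one_mul] at this
    rw [zero_add, pow_one, this, insertSum_succ]
    simp [insertSum]
    abel
  | succ k ih =>
    rw [pow_succ, harmonic_mul_incl_incl, ih, insertSum_succ _ _ (k + 1),
      insertSum_succ _ (incl (circ u v)) k, add_mul, pow_succ _ (k + 1)]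
    abel

/-- The sum telescopes: merging `v (s - i)` into `p ^ i` gives the insertions of `v (s - i + 1)`
into `p ^ (i - 1)`, which cancel those of the preceding term. -/
theorem sum_harmonic_pow_incl (v : ℕ → Z)
    (hv : ∀ i, 0 < i → circ (v 1) (v i) = v (i + 1)) (s k : ℕ) (hk : k < s) :
    ∑ i ∈ range (k + 1), (-1) ^ i * harmonic (incl (v 1) ^ i) (incl (v (s - i))) =
      (-1) ^ k * insertSum (incl (v 1)) (incl (v (s - k))) k := by
  induction k with
  | zero => simp [insertSum, one_harmonic]
  | succ k ih =>
    rw [sum_range_succ, ih (by omega), harmonic_pow_succ_incl, hv _ (by omega),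
      show s - (k + 1) + 1 = s - k by omega, mul_add, neg_one_pow_succ_mul, neg_one_pow_succ_mul]
    abel

/-- If `v` is multiplicative for `∘`, then `1 / (1 + v₁ X)` is the harmonic exponential of
`-∑_{n ≥ 1} v_n X^n / n`. -/
theorem geomSeries_eq_harmonicExp (v : ℕ → Z)
    (hv : ∀ i, 0 < i → circ (v 1) (v i) = v (i + 1)) (f : H1⟦X⟧)
    (hf : ∀ n, PowerSeries.coeff n f = incl (-(1 / (n : ℚ)) • v n)) :
    geomSeries (incl (v 1)) = harmonicExp f := by
  refine harmonicExp_eq_of_nsmul_coeff f _ _ hf (by simp) (by simp [coeff_geomSeries]) fun n => ?_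
  rcases n with _ | n
  · simp
  have hsmul (j : ℕ) (hj : 0 < j) : j • incl (-(1 / (j : ℚ)) • v j) = -incl (v j) := by
    rw [← map_nsmul, ← Nat.cast_smul_eq_nsmul ℚ, smul_smul, mul_neg,
      mul_one_div_cancel (by positivity), neg_smul, one_smul, map_neg]
  -- The term of index `n + 1` has weight zero. Telescoping the rest leaves the insertions of `v 1`
  -- into its own `n`-th power, that is, `n + 1` copies of the `(n + 1)`-st power.
  rw [Nat.sum_antidiagonal_eq_sum_range_succ_mk, sum_range_succ, Nat.sub_self, zero_smul, map_zero,
    add_zero, sum_congr rfl (g := fun i =>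
      -((-1) ^ i * harmonic (incl (v 1) ^ i) (incl (v (n + 1 - i))))), sum_neg_distrib,
    sum_harmonic_pow_incl v hv (n + 1) n n.lt_succ_self, Nat.add_sub_cancel_left, insertSum_self,
    coeff_geomSeries, mul_smul_comm, neg_one_pow_succ_mul, smul_neg]
  intro i hi
  rw [mem_range] at hi
  rw [hsmul _ (by omega), coeff_geomSeries, map_neg]
  rcases neg_one_pow_eq_or H1 i with h | h <;> simp [h]

end

/-! ### Transport from `ℚ[s]` to `𝔷`. -/

section

open Polynomial

/-- The `ℚ`-linear map `ℚ[s] → 𝔷` given by `s ^ i ↦ ħ ^ (-i) g_i` for `i ≥ 1` and `1 ↦ 0`. -/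
noncomputable def gMap : ℚ[X] →ₗ[ℚ] Z :=
  (Polynomial.basisMonomials ℚ).constr ℚ fun i => hbar (-(i : ℤ)) • gElt i

theorem gMap_X_pow (i : ℕ) : gMap (X ^ i) = hbar (-(i : ℤ)) • gElt i := by
  have h : (X ^ i : ℚ[X]) = Polynomial.basisMonomials ℚ i := by
    simp [Polynomial.X_pow_eq_monomial]
  rw [gMap, h, Module.Basis.constr_basis]

theorem hbar_mul_hbar (m n : ℤ) : hbar m * hbar n = hbar (m + n) :=
  (LaurentPolynomial.T_add m n).symm

theorem circ_gElt (i j : ℕ) (hi : 0 < i) (hj : 0 < j) :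
    circ (gElt i) (gElt j) = gElt (i + j) := by
  rw [gElt, gElt, gElt, dif_pos hi, dif_pos hj, dif_pos (by omega), circ_single]
  rfl

/-- Divisibility by `X` is essential: constants go to `0`, so multiplicativity fails on the whole
ring. -/
theorem circ_gMap (p q : ℚ[X]) (hp : X ∣ p) (hq : X ∣ q) :
    circ (gMap p) (gMap q) = gMap (p * q) := by
  obtain ⟨p, rfl⟩ := hp
  obtain ⟨q, rfl⟩ := hq
  induction p using Polynomial.induction_on' with
  | add p₁ p₂ h₁ h₂ => simp only [mul_add, add_mul, map_add, LinearMap.add_apply, h₁, h₂]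
  | monomial i a =>
    induction q using Polynomial.induction_on' with
    | add q₁ q₂ h₁ h₂ => simp only [mul_add, map_add, h₁, h₂]
    | monomial j b =>
      have h (i : ℕ) (a : ℚ) : X * monomial i a = a • (X ^ (i + 1) : ℚ[X]) := by
        rw [← Polynomial.smul_X_eq_monomial, mul_smul_comm, pow_succ']
      rw [h, h, smul_mul_smul_comm, ← pow_add, map_smul gMap, map_smul gMap, map_smul gMap,
        LinearMap.map_smul_of_tower circ, LinearMap.smul_apply,
        LinearMap.map_smul_of_tower (circ _), gMap_X_pow, gMap_X_pow, gMap_X_pow, map_smul circ,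
        LinearMap.smul_apply, map_smul (circ _),
        circ_gElt _ _ i.succ_pos j.succ_pos, smul_smul (hbar _), hbar_mul_hbar, smul_smul]
      congr 3
      push_cast
      ring

theorem gMap_phiPoly (k : ℕ) : gMap (phiPoly k) = hbar (-(k : ℤ)) • phi k := by
  rw [phiPoly, phi, map_sum, Finset.smul_sum]
  refine Finset.sum_congr rfl fun j _ => ?_
  rw [map_smul, gMap_X_pow, smul_comm (hbar (-(k : ℤ))), smul_smul (hbar _), hbar_mul_hbar]
  congr 3
  ring

theorem gMap_eElt (N : ℕ) (hN : 2 ≤ N) :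
    gMap (X ^ (N - 1) * (X + 1)) = hbar (-(N : ℤ)) • eElt N := by
  obtain ⟨n, rfl⟩ := Nat.exists_eq_add_of_le' hN
  rw [show n + 2 - 1 = n + 1 by omega, mul_add, ← pow_succ, mul_one, map_add, gMap_X_pow,
    gMap_X_pow, eElt, smul_add, smul_smul, hbar_mul_hbar]
  congr 3

theorem gMap_circPow (p : ℚ[X]) (u : Z) (m : ℤ) (hp : X ∣ p) (hu : gMap p = hbar m • u) (L : ℕ) :
    gMap (p ^ (L + 1)) = hbar (m * (L + 1 : ℕ)) • circPow u (L + 1) := by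
  induction L with
  | zero => simp [hu, circPow]
  | succ L ih =>
    rw [pow_succ, ← circ_gMap _ _ (dvd_pow hp L.succ_ne_zero) hp, ih, hu, map_smul, map_smul,
      LinearMap.smul_apply, smul_smul, hbar_mul_hbar, circPow]
    congr 2
    push_cast
    ring

theorem geomSeries_gMap (q : ℚ[X]) (hq : X ∣ q) (f : H1⟦X⟧)
    (hf : ∀ n, PowerSeries.coeff n f = incl (-(1 / (n : ℚ)) • gMap (q ^ n))) :
    geomSeries (incl (gMap q)) = harmonicExp f := by
  have := geomSeries_eq_harmonicExp (fun n => gMap (q ^ n)) (fun i hi => ?_) f hf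
  · simpa using this
  · rw [pow_one, circ_gMap _ _ hq (dvd_pow hq hi.ne'), pow_succ']

/-- Here `(a + b + 1)! / (a! b!)` equals the binomial coefficient times `(a + 1)(b + 1) / (a + b +
2)`, and this last fraction is `(N - 1)Ln / N`. -/
theorem exponent_scalar (N L n a b : ℕ) (hN : 2 ≤ N) (hL : 1 ≤ L) (hn : 1 ≤ n)
    (ha : L * n = a + 1) (hb : (N - 1) * L * n = b + 1) :
    ((N : ℚ) / (((N : ℚ) - 1) * L) * (1 / ((n : ℚ) ^ 2 * ((a + b + 2).choose (a + 1) : ℚ)))) *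
      (((a + b + 1).factorial : ℚ) / (a.factorial * b.factorial)) = 1 / (n : ℚ) := by
  have hc : ((a + b + 2).choose (a + 1) : ℚ) * (((a : ℚ) + 1) * a.factorial) *
      (((b : ℚ) + 1) * b.factorial) = ((a : ℚ) + b + 2) * (a + b + 1).factorial := by
    have := Nat.choose_mul_factorial_mul_factorial (show a + 1 ≤ a + b + 2 by omega)
    rw [show a + b + 2 - (a + 1) = b + 1 by omega, Nat.factorial_succ a, Nat.factorial_succ b,
      Nat.factorial_succ (a + b + 1)] at this
    exact_mod_cast this
  have ha' : (L : ℚ) * n = a + 1 := by exact_mod_cast ha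
  have hb' : ((N : ℚ) - 1) * L * n = b + 1 := by
    have : ((N - 1 : ℕ) : ℚ) = (N : ℚ) - 1 := by rw [Nat.cast_sub (by omega), Nat.cast_one]
    rw [← this]
    exact_mod_cast hb
  have hch : ((a + b + 2).choose (a + 1) : ℚ) ≠ 0 :=
    Nat.cast_ne_zero.2 (Nat.choose_pos (by omega)).ne'
  have hfa : (a.factorial : ℚ) ≠ 0 := Nat.cast_ne_zero.2 a.factorial_ne_zero
  have hfb : (b.factorial : ℚ) ≠ 0 := Nat.cast_ne_zero.2 b.factorial_ne_zero
  have hn0 : (n : ℚ) ≠ 0 := by positivity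
  have hL0 : (L : ℚ) ≠ 0 := by positivity
  have hN2 : (2 : ℚ) ≤ N := by exact_mod_cast hN
  have hN0 : (N : ℚ) ≠ 0 := by positivity
  have hN1 : (N : ℚ) - 1 ≠ 0 := by linarith
  have hab : (a : ℚ) + b + 2 = N * L * n := by linear_combination -ha' - hb'
  rw [← ha', ← hb', hab] at hc
  have hf : ((a + b + 1).factorial : ℚ) = ((a + b + 2).choose (a + 1) : ℚ) * a.factorial *
      b.factorial * (((N : ℚ) - 1) * L * n) / N := by
    rw [eq_div_iff hN0]
    apply mul_left_cancel₀ (mul_ne_zero hL0 hn0)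
    linear_combination -hc
  rw [hf]
  field_simp

theorem coeff_exponent (N L n : ℕ) (hN : 2 ≤ N) (hL : 1 ≤ L) :
    PowerSeries.coeff n (exponent N L) = incl (-(1 / (n : ℚ)) •
      gMap (((-1 : ℚ) ^ ((N - 1) * L) • (X ^ (N - 1) * (X + 1)) ^ L) ^ n)) := by
  rw [exponent, PowerSeries.coeff_mk]
  rcases Nat.eq_zero_or_pos n with rfl | hn
  · simp
  rw [if_neg hn.ne']
  obtain ⟨a, ha⟩ : ∃ a, L * n = a + 1 := Nat.exists_eq_succ_of_ne_zero (by positivity)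
  obtain ⟨b, hb⟩ : ∃ b, (N - 1) * L * n = b + 1 :=
    Nat.exists_eq_succ_of_ne_zero (by have : 0 < N - 1 := by omega
                                      positivity)
  have hab : N * L * n = a + b + 2 := by
    obtain ⟨M, rfl⟩ : ∃ M, N = M + 1 := ⟨N - 1, by omega⟩
    rw [Nat.add_sub_cancel] at hb
    linarith [show (M + 1) * L * n = M * L * n + L * n by ring]
  have hsum : ∑ k ∈ Finset.Icc 2 (a + b + 2),
      convHarmonic (k - 2) (a + 1) (b + 1) • incl (hbar (-(k : ℤ)) • phi k) =
      incl (gMap (((-1) ^ b * ((a + b + 1).factorial : ℚ) / (a.factorial * b.factorial)) •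
        (X ^ (b + 1) * (X + 1) ^ (a + 1)))) := by
    rw [← sum_convHarmonic_smul_phiPoly, map_sum, map_sum]
    refine Finset.sum_congr rfl fun k _ => ?_
    rw [map_smul gMap, gMap_phiPoly]
    exact (LinearMap.map_smul_of_tower incl _ _).symm
  have hq : ((-1 : ℚ) ^ ((N - 1) * L) • (X ^ (N - 1) * (X + 1) : ℚ[X]) ^ L) ^ n =
      (-1 : ℚ) ^ (b + 1) • (X ^ (b + 1) * (X + 1) ^ (a + 1)) := by
    rw [_root_.smul_pow, ← pow_mul, hb, ← pow_mul, mul_pow, ← pow_mul, ← mul_assoc, hb, ha]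
  rw [hab, ha, hb, hsum, hq, ← LinearMap.map_smul_of_tower incl, ← map_smul gMap, ← map_smul gMap,
    smul_smul, smul_smul, mul_div_assoc, mul_left_comm, exponent_scalar N L n a b hN hL hn ha hb]
  -- The remaining sign is `(-1) ^ b = -(-1) ^ (b + 1)`, which supplies the minus sign of the
  -- logarithm.
  congr 3
  ring

end

end HarmonicAlgebra

/-- For `N ≥ 2` and `L ≥ 1`, the formal power series
`1 / (1 + (-1)^{(N-1)L} ħ^{-NL} e_N^{∘ L} X)` is the exponential, with respect to the harmonic
product, of
`N / ((N-1) L) ∑_{n ≥ 1} X^n / (n² binom(NLn, Ln)) ∑_{k=2}^{NLn} C_{k-2}(Ln, (N-1)Ln) ħ^{-k} φ_k`. -/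
theorem theorem4p5 (N L : ℕ) (hN : 2 ≤ N) (hL : 1 ≤ L) :
    HarmonicAlgebra.geomSeries
        (HarmonicAlgebra.incl
          ((-1 : HarmonicAlgebra.Coeff) ^ ((N - 1) * L) •
            HarmonicAlgebra.hbar (-((N : ℤ) * (L : ℤ))) •
              HarmonicAlgebra.circPow (HarmonicAlgebra.eElt N) L)) =
      HarmonicAlgebra.harmonicExp (HarmonicAlgebra.exponent N L) := by
  have hdvd : (Polynomial.X : Polynomial ℚ) ∣
      Polynomial.X ^ (N - 1) * (Polynomial.X + 1) :=
    (dvd_pow_self _ (by omega)).mul_right _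
  have hpow := HarmonicAlgebra.gMap_circPow _ _ _ hdvd (HarmonicAlgebra.gMap_eElt N hN) (L - 1)
  rw [Nat.sub_add_cancel hL, neg_mul] at hpow
  have hsign (z : HarmonicAlgebra.Z) (k : ℕ) :
      (-1 : HarmonicAlgebra.Coeff) ^ k • z = (-1 : ℚ) ^ k • z := by
    rcases neg_one_pow_eq_or ℚ k with h | h <;>
      rcases Nat.even_or_odd k with hk | hk <;> simp [hk.neg_one_pow]
  rw [← hpow, hsign, ← map_smul]
  exact HarmonicAlgebra.geomSeries_gMap _
    (dvd_smul_of_dvd _ (dvd_pow hdvd (by omega))) _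
    fun n => HarmonicAlgebra.coeff_exponent N L n hN hL
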